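/- Let $K$ be a connected two-dimensional CW-complex with subcomplexes $K_1,K_2,K_3$ such that $K_1\cup K_2\cup K_3=K$ and $K_1\cap K_2\cap K_3=K^1$ is the 1-skeleton of $K$. Put $F=\pi_1(K^1)$, a free group, and $R_i=\ker\{\pi_1(K^1)\to\pi_1(K_i)\}$, the normal closure in $F$ of the attaching elements $r_\alpha\in F$ of the 2-cells $\alpha$ of $K_i$. Write $[x,y]=x^{-1}y^{-1}xy$ and $x^y=y^{-1}xy$. The group $\pi_2(K,K^1)$ is the free crossed module over $F$ with generators $e_\alpha^w$ ($\alpha$ a 2-cell of $K$, $w\in F$), relations $e_\alpha^v e_\beta^w (e_\alpha^{v})^{-1}=e_\beta^{u}$ with $u=vr_\alpha v^{-1}w$, and boundary $\partial e_\alpha^w=wr_\alpha w^{-1}$; $\pi_2(K)=\ker\partial$ is an abelian group, written additively, and likewise for $K_i$, with $i_j:\pi_2(K_j)\to\pi_2(K)$ induced by inclusion. Let $$I_3(F;R_1,R_2,R_3)=\frac{R_1\cap R_2\cap R_3}{[R_1,R_2\cap R_3]\,[R_2,R_3\cap R_1]\,[R_3,R_1\cap R_2]},$$ an abelian group, written additively.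 An identity sequence is a finite sequence $c=(c_1,\dots,c_m)$ of terms $c_j=(w_jr_{\alpha_j}w_j^{-1})^{\pm1}$, each with a chosen index $i\in\{1,2,3\}$ such that $\alpha_j$ is a cell of $K_i$, with $c_1\cdots c_m=1$ in $F$. It represents the element $\langle c\rangle=(e_{\alpha_1}^{w_1})^{\pm1}\cdots(e_{\alpha_m}^{w_m})^{\pm1}$ of $\pi_2(K)$, and every element of $\pi_2(K)$ is so represented. Let $r_c\in R_1$ be the product, in order, of the terms of index $1$, and let $s_c\in R_2$ be the product, in order, of the terms of index $2$, each conjugated, $x\mapsto x^y$, by the product $y$ of the later terms of index $1$. Then $r_cs_c\in R_3$, and $$\Lambda_x:\pi_2(K)/(i_1\pi_2(K_1)+i_2\pi_2(K_2)+i_3\pi_2(K_3))\to I_3(F;R_1,R_2,R_3),\qquad \langle c\rangle\mapsto\text{class of }[r_c,s_c],$$ is a well-defined map. Let $\Lambda:\pi_2(K)\to I_3(F;R_1,R_2,R_3)$ be the composite of the natural projection with $\Lambda_x$. **Theorem.** The map $\Lambda$ is a homogeneous quadratic map: the cross-effect $\Lambda(a,b)=\Lambda(a+b)-\Lambda(a)-\Lambda(b)$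 is bilinear in $a,b\in\pi_2(K)$, and $\Lambda(-x)=\Lambda(x)$ for all $x\in\pi_2(K)$. Moreover, if $a,b$ are represented by identity sequences $c(a),c(b)$ and $x_1=r_{c(a)}$, $y_1=s_{c(a)}$, $x_2=r_{c(b)}$, $y_2=s_{c(b)}$, then $[y_2^{-1},x_1][y_1^{-1},x_2]\in R_1\cap R_2\cap R_3$ and $\Lambda(a,b)$ is its class in $I_3(F;R_1,R_2,R_3)$. -/

import Mathlib

universe u v

/-- The commutator convention `[x, y] = x⁻¹ y⁻¹ x y`. -/
def rcomm {F : Type u} [Group F] (x y : F) : F := x⁻¹ * y⁻¹ * x * y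

/-! ### The free crossed module `π₂(K, K¹) → π₁(K¹)` and `π₂(K)` -/

section CrossedModule

variable {F : Type u} [Group F] {A : Type v}

/-- The Peiffer relators `e_α^v e_β^w e_α^{-v} e_β^{-u}`, `u = v r_α v⁻¹ w`, on the symbols
`e_α^w = (α, w)`; `r α ∈ F` is the attaching element of the 2-cell `α`. -/
def peifferRels (r : A → F) : Set (FreeGroup (A × F)) :=
  {x | ∃ (α β : A) (p q : F), x = FreeGroup.of (α, p) * FreeGroup.of (β, q) *
    (FreeGroup.of (α, p))⁻¹ * (FreeGroup.of (β, p * r α * p⁻¹ * q))⁻¹}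

/-- The relative group `π₂(K, K¹)` of the 2-complex with `π₁(K¹) = F`, 2-cells `A` and attaching
elements `r`: generators `e_α^w`, Peiffer relations. -/
abbrev RelPi2 (r : A → F) : Type (max u v) := PresentedGroup (peifferRels r)

/-- The generator `e_α^w` of `π₂(K, K¹)`. -/
def cellGen (r : A → F) (α : A) (w : F) : RelPi2 r := PresentedGroup.of (α, w)

theorem cellGen_peiffer (r : A → F) (α β : A) (p q : F) :
    cellGen r α p * cellGen r β q * (cellGen r α p)⁻¹ = cellGen r β (p * r α * p⁻¹ * q) := by
  have h : (PresentedGroup.mk (peifferRels r)) (FreeGroup.of (α, p) * FreeGroup.of (β, q) *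
    (FreeGroup.of (α, p))⁻¹ * (FreeGroup.of (β, p * r α * p⁻¹ * q))⁻¹) = 1 :=
    PresentedGroup.one_of_mem ⟨α, β, p, q, rfl⟩
  rw [map_mul, map_inv] at h
  have h2 := mul_inv_eq_one.1 h
  rw [map_mul, map_mul, map_inv] at h2
  exact h2

/-- The boundary `∂ : π₂(K, K¹) → π₁(K¹)`, `e_α^w ↦ w r_α w⁻¹`. -/
def bdry (r : A → F) : RelPi2 r →* F :=
  PresentedGroup.toGroup (f := fun x : A × F => x.2 * r x.1 * x.2⁻¹) (by
    rintro _ ⟨α, β, p, q, rfl⟩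
    simp only [map_mul, map_inv, FreeGroup.lift_apply_of]
    group)

theorem bdry_cellGen (r : A → F) (α : A) (w : F) : bdry r (cellGen r α w) = w * r α * w⁻¹ :=
  PresentedGroup.toGroup.of _

theorem cellGen_conj (r : A → F) (x : RelPi2 r) :
    ∀ (β : A) (q : F), x * cellGen r β q * x⁻¹ = cellGen r β (bdry r x * q) := by
  have hx : x ∈ Subgroup.closure (Set.range (PresentedGroup.of (rels := peifferRels r))) := by
    rw [PresentedGroup.closure_range_of]; trivial
  induction hx using Subgroup.closure_induction with
  | mem x hx =>
    obtain ⟨⟨α, p⟩, rfl⟩ := hx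
    intro β q
    have := cellGen_peiffer r α β p q
    have h2 := bdry_cellGen r α p
    unfold cellGen at this h2 ⊢
    rw [this, h2]
  | one => intro β q; simp
  | mul x y _ _ hx hy =>
    intro β q
    have : x * y * cellGen r β q * (x * y)⁻¹ = x * (y * cellGen r β q * y⁻¹) * x⁻¹ := by group
    rw [this, hy, hx, map_mul, mul_assoc]
  | inv x _ hx =>
    intro β q
    have := hx β ((bdry r x)⁻¹ * q)
    rw [mul_inv_cancel_left] at this
    rw [← this, map_inv]
    group

/-- Elements of `ker ∂` are central in `π₂(K, K¹)`. -/
theorem ker_bdry_comm (r : A → F) (x y : RelPi2 r) (hx : bdry r x = 1) : x * y = y * x := by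
  have hy : y ∈ Subgroup.closure (Set.range (PresentedGroup.of (rels := peifferRels r))) := by
    rw [PresentedGroup.closure_range_of]; trivial
  induction hy using Subgroup.closure_induction with
  | mem y hy =>
    obtain ⟨⟨β, q⟩, rfl⟩ := hy
    have := cellGen_conj r x β q
    rw [hx, one_mul] at this
    exact mul_inv_eq_iff_eq_mul.1 this
  | one => simp
  | mul y z _ _ hy hz => rw [← mul_assoc, hy, mul_assoc, hz, mul_assoc]
  | inv y _ hy =>
    rw [eq_inv_mul_iff_mul_eq, ← mul_assoc, ← hy, mul_assoc, mul_inv_cancel, mul_one]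

/-- `π₂(K) = ker (∂ : π₂(K, K¹) → π₁(K¹))`, written additively. -/
abbrev Pi2 (r : A → F) : Type (max u v) := Additive (bdry r).ker

instance instCommGroupKerBdry (r : A → F) : CommGroup (bdry r).ker :=
  { (inferInstance : Group (bdry r).ker) with
    mul_comm := fun x y => Subtype.ext (ker_bdry_comm r x y x.2) }

/-- The map `π₂(L, L¹) → π₂(K, K¹)` induced by the inclusion of the subcomplex `L ⊇ K¹` of `K`
whose set of 2-cells is `S`. -/
def relIncl (r : A → F) (S : Set A) : RelPi2 (fun a : S => r a) →* RelPi2 r :=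
  PresentedGroup.toGroup (f := fun x : S × F => cellGen r x.1 x.2) (by
    rintro _ ⟨α, β, p, q, rfl⟩
    simp only [map_mul, map_inv, FreeGroup.lift_apply_of]
    rw [cellGen_peiffer, mul_inv_cancel])

theorem relIncl_cellGen (r : A → F) (S : Set A) (α : S) (w : F) :
    relIncl r S (cellGen (fun a : S => r a) α w) = cellGen r α w :=
  PresentedGroup.toGroup.of _

theorem bdry_relIncl (r : A → F) (S : Set A) (x : RelPi2 (fun a : S => r a)) :
    bdry r (relIncl r S x) = bdry (fun a : S => r a) x := by
  have : (bdry r).comp (relIncl r S) = bdry (fun a : S => r a) := by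
    apply PresentedGroup.ext
    rintro ⟨α, w⟩
    have h1 := relIncl_cellGen r S α w
    have h2 := bdry_cellGen r α w
    have h3 := bdry_cellGen (fun a : S => r a) α w
    unfold cellGen at h1 h2 h3
    rw [MonoidHom.comp_apply, h1, h2, h3]
  exact DFunLike.congr_fun this x

/-- The map `π₂(L) → π₂(K)` induced by the inclusion of a subcomplex. -/
def pi2Incl (r : A → F) (S : Set A) : Pi2 (fun a : S => r a) →+ Pi2 r :=
  MonoidHom.toAdditive (((relIncl r S).comp (Subgroup.subtype _)).codRestrict (bdry r).ker
    (fun x => by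
      rw [MonoidHom.mem_ker, MonoidHom.comp_apply, bdry_relIncl]
      exact x.2))

/-- The fundamental group `π₁(K) = F / ⟨r_α⟩^F`. -/
abbrev Pi1 (r : A → F) : Type u := F ⧸ Subgroup.normalClosure (Set.range r)

/-- `ker (π₁(K¹) → π₁(K))`. -/
def relatorSubgroup (r : A → F) : Subgroup F :=
  (QuotientGroup.mk' (Subgroup.normalClosure (Set.range r)) : F →* Pi1 r).ker

instance instNormalRelatorSubgroup (r : A → F) : (relatorSubgroup r).Normal := by
  unfold relatorSubgroup; infer_instance

end CrossedModule

/-! ### The group `I₃(F; R₁, R₂, R₃)` -/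

section I3

variable {F : Type u} [Group F] (R : Fin 3 → Subgroup F)

/-- `[R₁, R₂ ∩ R₃] [R₂, R₃ ∩ R₁] [R₃, R₁ ∩ R₂]` (indices shifted to `0, 1, 2`). -/
def commProd : Subgroup F :=
  ⁅R 0, R 1 ⊓ R 2⁆ ⊔ ⁅R 1, R 2 ⊓ R 0⁆ ⊔ ⁅R 2, R 0 ⊓ R 1⁆

/-- `R₁ ∩ R₂ ∩ R₃`. -/
def tripleInf : Subgroup F := R 0 ⊓ R 1 ⊓ R 2

variable [hR : ∀ i, (R i).Normal]

instance instNormalCommProd : (commProd R).Normal := by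
  unfold commProd; infer_instance

theorem commute_mod₀ {a b : F} (ha : a ∈ R 0) (hb : b ∈ R 1) (hb' : b ∈ R 2) :
    Commute (a : F ⧸ commProd R) b := by
  have h : a⁻¹ * b⁻¹ * (a⁻¹)⁻¹ * (b⁻¹)⁻¹ ∈ commProd R :=
    Subgroup.mem_sup_left (Subgroup.mem_sup_left
      (Subgroup.commutator_mem_commutator (inv_mem ha) (inv_mem (Subgroup.mem_inf.2 ⟨hb, hb'⟩))))
  refine (QuotientGroup.eq.2 ?_ : ((b * a : F) : F ⧸ commProd R) = (a * b : F)).symm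
  convert h using 1
  group

theorem commute_mod₁ {a b : F} (ha : a ∈ R 1) (hb : b ∈ R 2) (hb' : b ∈ R 0) :
    Commute (a : F ⧸ commProd R) b := by
  have h : a⁻¹ * b⁻¹ * (a⁻¹)⁻¹ * (b⁻¹)⁻¹ ∈ commProd R :=
    Subgroup.mem_sup_left (Subgroup.mem_sup_right
      (Subgroup.commutator_mem_commutator (inv_mem ha) (inv_mem (Subgroup.mem_inf.2 ⟨hb, hb'⟩))))
  refine (QuotientGroup.eq.2 ?_ : ((b * a : F) : F ⧸ commProd R) = (a * b : F)).symm
  convert h using 1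
  group

theorem commute_mod₂ {a b : F} (ha : a ∈ R 2) (hb : b ∈ R 0) (hb' : b ∈ R 1) :
    Commute (a : F ⧸ commProd R) b := by
  have h : a⁻¹ * b⁻¹ * (a⁻¹)⁻¹ * (b⁻¹)⁻¹ ∈ commProd R :=
    Subgroup.mem_sup_right
      (Subgroup.commutator_mem_commutator (inv_mem ha) (inv_mem (Subgroup.mem_inf.2 ⟨hb, hb'⟩)))
  refine (QuotientGroup.eq.2 ?_ : ((b * a : F) : F ⧸ commProd R) = (a * b : F)).symm
  convert h using 1
  group

/-- `I₃(F; R₁, R₂, R₃) = (R₁ ∩ R₂ ∩ R₃) / [R₁, R₂ ∩ R₃] [R₂, R₃ ∩ R₁] [R₃, R₁ ∩ R₂]`, written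
additively. -/
abbrev I3 : Type u := Additive (tripleInf R ⧸ (commProd R).subgroupOf (tripleInf R))

instance instCommGroupI3 : CommGroup (tripleInf R ⧸ (commProd R).subgroupOf (tripleInf R)) :=
  { (inferInstance : Group (tripleInf R ⧸ (commProd R).subgroupOf (tripleInf R))) with
    mul_comm := by
      intro x y
      obtain ⟨a, rfl⟩ := QuotientGroup.mk_surjective x
      obtain ⟨b, rfl⟩ := QuotientGroup.mk_surjective y
      refine QuotientGroup.eq.2 (Subgroup.mem_subgroupOf.2 ?_)
      exact QuotientGroup.eq.1 (commute_mod₀ R a.2.1.1 b.2.1.2 b.2.2).eq }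

/-- The class in `I₃` of an element of `R₁ ∩ R₂ ∩ R₃`. -/
def I3.mk (z : F) (hz : z ∈ tripleInf R) : I3 R :=
  Additive.ofMul (QuotientGroup.mk (⟨z, hz⟩ : tripleInf R))

theorem I3.mk_eq_of {z z' : F} (hz : z ∈ tripleInf R) (hz' : z' ∈ tripleInf R)
    (h : (QuotientGroup.mk z : F ⧸ commProd R) = QuotientGroup.mk z') :
    I3.mk R z hz = I3.mk R z' hz' :=
  congrArg Additive.ofMul (QuotientGroup.eq.2 (Subgroup.mem_subgroupOf.2 (QuotientGroup.eq.1 h)))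

end I3

/-! ### Complexes with three subcomplexes -/

/-- A connected 2-dimensional complex `K` with `π₁(K¹) = F`, together with subcomplexes
`K₁, K₂, K₃` such that `K₁ ∪ K₂ ∪ K₃ = K` and `K₁ ∩ K₂ ∩ K₃ = K¹`: the set of 2-cells, their
attaching elements in `F`, and for each `i` the set of 2-cells of `Kᵢ` (indices `0, 1, 2`). -/
structure TriComplex (F : Type u) [Group F] where
  Cell : Type v
  attach : Cell → F
  sub : Fin 3 → Set Cell
  cover : ∀ α : Cell, ∃ i, α ∈ sub i
  inter : ∀ α : Cell, ¬ ∀ i, α ∈ sub i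

namespace TriComplex

variable {F : Type u} [Group F] (K : TriComplex.{u, v} F)

/-- `Rᵢ = ker (π₁(K¹) → π₁(Kᵢ))`. -/
def R (i : Fin 3) : Subgroup F := relatorSubgroup (fun α : K.sub i => K.attach α)

instance instNormalR (i : Fin 3) : (K.R i).Normal := by unfold R; infer_instance

/-- `i₁ π₂(K₁) + i₂ π₂(K₂) + i₃ π₂(K₃) ⊆ π₂(K)`. -/
def subSum : AddSubgroup (Pi2 K.attach) := ⨆ i : Fin 3, (pi2Incl K.attach (K.sub i)).range

/-- A letter: a conjugate `(w r_α w⁻¹)^{±1}` of an attaching element or its inverse, recorded with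
an index `i` such that `α` is a cell of `Kᵢ`. -/
structure Letter where
  idx : Fin 3
  cell : K.sub idx
  conj : F
  neg : Bool

variable {K}

/-- The element of `π₁(K¹)` given by a letter. -/
def Letter.val (l : K.Letter) : F :=
  if l.neg then (l.conj * K.attach l.cell * l.conj⁻¹)⁻¹ else l.conj * K.attach l.cell * l.conj⁻¹

/-- The element `(e_α^w)^{±1}` of `π₂(K, K¹)` given by a letter. -/
def Letter.rel (l : K.Letter) : RelPi2 K.attach :=
  if l.neg then (cellGen K.attach l.cell l.conj)⁻¹ else cellGen K.attach l.cell l.conj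

theorem Letter.bdry_rel (l : K.Letter) : bdry K.attach l.rel = l.val := by
  unfold Letter.rel Letter.val
  split_ifs <;> simp [bdry_cellGen]

/-- `r_c`: the product of the terms of index 1, in order. -/
def rPart : List K.Letter → F
  | [] => 1
  | l :: c => if l.idx = 0 then l.val * rPart c else rPart c

/-- `s_c`: the product of the terms of index 2, in order, each conjugated (`x^y = y⁻¹ x y`) by the
product of the later terms of index 1. -/
def sPart : List K.Letter → F
  | [] => 1
  | l :: c => if l.idx = 1 then ((rPart c)⁻¹ * l.val * rPart c) * sPart c else sPart c

/-- `t_c`: the product of the terms of index 3, in order, each conjugated by the product of the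
later terms of index 1 followed by the product of the later (conjugated) terms of index 2. -/
def tPart : List K.Letter → F
  | [] => 1
  | l :: c => if l.idx = 2 then ((rPart c * sPart c)⁻¹ * l.val * (rPart c * sPart c)) * tPart c
      else tPart c

theorem Letter.val_mem (l : K.Letter) : l.val ∈ K.R l.idx := by
  have h : K.attach l.cell ∈ K.R l.idx := by
    unfold R relatorSubgroup
    rw [QuotientGroup.ker_mk']
    exact Subgroup.subset_normalClosure ⟨l.cell, rfl⟩
  have h2 := (K.instNormalR l.idx).conj_mem _ h l.conj
  unfold Letter.val
  split_ifs
  · exact inv_mem h2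
  · exact h2

theorem rPart_mem (c : List K.Letter) : rPart c ∈ K.R 0 := by
  induction c with
  | nil => exact one_mem _
  | cons l c ih =>
    unfold rPart
    split_ifs with h
    · exact mul_mem (h ▸ l.val_mem) ih
    · exact ih

theorem sPart_mem (c : List K.Letter) : sPart c ∈ K.R 1 := by
  induction c with
  | nil => exact one_mem _
  | cons l c ih =>
    unfold sPart
    split_ifs with h
    · exact mul_mem ((K.instNormalR 1).conj_mem' _ (h ▸ l.val_mem) _) ih
    · exact ih

theorem tPart_mem (c : List K.Letter) : tPart c ∈ K.R 2 := by
  induction c with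
  | nil => exact one_mem _
  | cons l c ih =>
    unfold tPart
    split_ifs with h
    · exact mul_mem ((K.instNormalR 2).conj_mem' _ (h ▸ l.val_mem) _) ih
    · exact ih

theorem prod_parts (c : List K.Letter) :
    rPart c * sPart c * tPart c = (c.map Letter.val).prod := by
  induction c with
  | nil => simp [rPart, sPart, tPart]
  | cons l c ih =>
    rw [List.map_cons, List.prod_cons, ← ih]
    have : l.idx = 0 ∨ l.idx = 1 ∨ l.idx = 2 := by
      generalize l.idx = i
      fin_cases i <;> simp
    rcases this with h | h | h <;> simp [rPart, sPart, tPart, h, mul_assoc]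

variable (K)

/-- Identity sequences: finite sequences of letters whose product is trivial in `π₁(K¹)`. -/
def IdSeq : Type (max u v) := {c : List K.Letter // (c.map Letter.val).prod = 1}

variable {K}

theorem bdry_prod_rel (c : List K.Letter) :
    bdry K.attach (c.map Letter.rel).prod = (c.map Letter.val).prod := by
  rw [map_list_prod, List.map_map]
  congr 2
  funext l
  exact l.bdry_rel

/-- The element of `π₂(K)` represented by an identity sequence. -/
def IdSeq.cls (c : K.IdSeq) : Pi2 K.attach :=
  Additive.ofMul ⟨(c.1.map Letter.rel).prod, by
    rw [MonoidHom.mem_ker, bdry_prod_rel]; exact c.2⟩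

/-- `r_c ∈ R₁`. -/
def IdSeq.r (c : K.IdSeq) : F := rPart c.1

/-- `s_c ∈ R₂`. -/
def IdSeq.s (c : K.IdSeq) : F := sPart c.1

theorem IdSeq.r_mul_s_mem (c : K.IdSeq) : c.r * c.s ∈ K.R 2 := by
  have h := prod_parts c.1
  rw [c.2] at h
  rw [IdSeq.r, IdSeq.s, mul_eq_one_iff_eq_inv.1 h]
  exact inv_mem (tPart_mem _)

theorem rcomm_mem {x y : F} (hx : x ∈ K.R 0) (hy : y ∈ K.R 1) (hxy : x * y ∈ K.R 2) :
    rcomm x y ∈ tripleInf K.R := by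
  unfold rcomm
  refine ⟨⟨?_, ?_⟩, ?_⟩
  · rw [mul_assoc, mul_assoc]
    refine mul_mem ((K.R 0).inv_mem hx) ?_
    rw [← mul_assoc]
    exact (K.instNormalR 0).conj_mem' _ hx y
  · exact mul_mem ((K.instNormalR 1).conj_mem' _ ((K.R 1).inv_mem hy) x) hy
  · have h : y * x ∈ K.R 2 := (K.instNormalR 2).mem_comm hxy
    have : x⁻¹ * y⁻¹ * x * y = (y * x)⁻¹ * (x * y) := by group
    rw [this]
    exact mul_mem ((K.R 2).inv_mem h) hxy

/-- The class of `[r_c, s_c]` in `I₃(F; R₁, R₂, R₃)`. -/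
def IdSeq.value (c : K.IdSeq) : I3 K.R :=
  I3.mk K.R (rcomm c.r c.s) (rcomm_mem (rPart_mem c.1) (sPart_mem c.1) c.r_mul_s_mem)

/-! ### The map `Λ` is well defined -/

section WellDefined

variable (K)

/-- Auxiliary group of pairs `(p, q)`, `p ∈ R₁`, `p⁻¹ q ∈ R₂`; a sequence `c` gives the pair
`(r_c, r_c s_c)`. -/
def pairGroup : Subgroup (F × F) where
  carrier := {x | x.1 ∈ K.R 0 ∧ x.1⁻¹ * x.2 ∈ K.R 1}
  one_mem' := by simp [one_mem]
  mul_mem' := by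
    rintro ⟨p, q⟩ ⟨p', q'⟩ ⟨h1, h2⟩ ⟨h3, h4⟩
    refine ⟨mul_mem h1 h3, ?_⟩
    have : (p * p')⁻¹ * (q * q') = (p'⁻¹ * (p⁻¹ * q) * p') * (p'⁻¹ * q') := by group
    change (p * p')⁻¹ * (q * q') ∈ K.R 1
    rw [this]
    exact mul_mem ((K.instNormalR 1).conj_mem' _ h2 p') h4
  inv_mem' := by
    rintro ⟨p, q⟩ ⟨h1, h2⟩
    refine ⟨(K.R 0).inv_mem h1, ?_⟩
    have : (p⁻¹)⁻¹ * q⁻¹ = p * (p⁻¹ * q)⁻¹ * p⁻¹ := by group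
    change (p⁻¹)⁻¹ * q⁻¹ ∈ K.R 1
    rw [this]
    exact (K.instNormalR 1).conj_mem _ ((K.R 1).inv_mem h2) p

/-- Auxiliary: the pairs in `pairGroup` coming from identity sequences. -/
def pairGroup₀ : Subgroup (F × F) := K.pairGroup ⊓ (K.R 2).comap (MonoidHom.snd F F)

/-- Auxiliary: translations which preserve `pairGroup₀` and `[p, q]` modulo `commProd`. -/
def invariants : Subgroup (F × F) where
  carrier := {d | d ∈ K.pairGroup₀ ∧ ∀ x ∈ K.pairGroup₀,
    ((rcomm (x.1 * d.1) (x.2 * d.2) : F) : F ⧸ commProd K.R) = (rcomm x.1 x.2 : F)}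
  one_mem' := ⟨one_mem _, by simp⟩
  mul_mem' := by
    rintro d e ⟨h1, h2⟩ ⟨h3, h4⟩
    refine ⟨mul_mem h1 h3, fun x hx => ?_⟩
    have := h4 (x * d) (mul_mem hx h1)
    rw [Prod.fst_mul, Prod.snd_mul, ← mul_assoc, ← mul_assoc]
    exact this.trans (h2 x hx)
  inv_mem' := by
    rintro d ⟨h1, h2⟩
    refine ⟨inv_mem h1, fun x hx => ?_⟩
    have := h2 (x * d⁻¹) (mul_mem hx (inv_mem h1))
    simp only [Prod.fst_mul, Prod.snd_mul, Prod.fst_inv, Prod.snd_inv, inv_mul_cancel_right]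
      at this ⊢
    exact this.symm

/-- Auxiliary: the largest normal subgroup of `pairGroup` contained in `invariants`. -/
def invCore : Subgroup K.pairGroup := (K.invariants.subgroupOf K.pairGroup).normalCore

instance instNormalInvCore : K.invCore.Normal := by unfold invCore; infer_instance

variable {K}

theorem inv₀ {k : F} (h0 : k ∈ K.R 0) (h1 : k ∈ K.R 1) : ((k, 1) : F × F) ∈ K.invariants := by
  refine ⟨⟨⟨h0, ?_⟩, (K.R 2).one_mem⟩, ?_⟩
  · simpa using (K.R 1).inv_mem h1
  rintro ⟨p, q⟩ ⟨⟨hp, hpq⟩, hq⟩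
  have hc := commute_mod₂ K.R ((K.instNormalR 2).conj_mem' _ ((K.R 2).inv_mem hq) p) h0 h1
  have e1 : rcomm (p * k) (q * 1) = k⁻¹ * ((p⁻¹ * q⁻¹ * p) * k) * q := by unfold rcomm; group
  have e2 : rcomm p q = k⁻¹ * (k * (p⁻¹ * q⁻¹ * p)) * q := by unfold rcomm; group
  change ((rcomm (p * k) (q * 1) : F) : F ⧸ commProd K.R) = (rcomm p q : F)
  rw [e1, e2]
  have := hc.eq
  simp only [QuotientGroup.mk_mul, QuotientGroup.mk_inv, MonoidHom.coe_snd] at this ⊢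
  rw [this]

theorem inv₁ {k : F} (h0 : k ∈ K.R 0) (h2 : k ∈ K.R 2) : ((k, k) : F × F) ∈ K.invariants := by
  refine ⟨⟨⟨h0, ?_⟩, h2⟩, ?_⟩
  · simp [one_mem]
  rintro ⟨p, q⟩ ⟨⟨hp, hpq⟩, hq⟩
  have hpq' : q⁻¹ * p ∈ K.R 1 := by simpa using (K.R 1).inv_mem hpq
  have hr : rcomm p q ∈ K.R 1 := by
    have : rcomm p q = (p⁻¹ * (q⁻¹ * p) * p) * (p⁻¹ * q) := by unfold rcomm; group
    rw [this]
    exact mul_mem ((K.instNormalR 1).conj_mem' _ hpq' p) hpq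
  have hc := (commute_mod₁ K.R hpq' h2 h0).eq
  have hd := (commute_mod₁ K.R hr h2 h0).eq
  have e1 : rcomm (p * k) (q * k) = k⁻¹ * p⁻¹ * k⁻¹ * ((q⁻¹ * p) * k) * q * k := by
    unfold rcomm; group
  have e2 : k⁻¹ * p⁻¹ * k⁻¹ * (k * (q⁻¹ * p)) * q * k = k⁻¹ * (rcomm p q * k) := by
    unfold rcomm; group
  have e3 : k⁻¹ * (k * rcomm p q) = rcomm p q := by group
  change ((rcomm (p * k) (q * k) : F) : F ⧸ commProd K.R) = (rcomm p q : F)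
  calc ((rcomm (p * k) (q * k) : F) : F ⧸ commProd K.R)
      = ((k⁻¹ * p⁻¹ * k⁻¹ : F) : F ⧸ commProd K.R) * (((q⁻¹ * p : F) : F ⧸ commProd K.R) * k) *
          q * k := by rw [e1]; rfl
    _ = ((k⁻¹ * (rcomm p q * k) : F) : F ⧸ commProd K.R) := by rw [hc, ← e2]; rfl
    _ = ((k⁻¹ : F) : F ⧸ commProd K.R) * (((rcomm p q : F) : F ⧸ commProd K.R) * k) := rfl
    _ = (rcomm p q : F) := by rw [hd]; exact congrArg _ e3

theorem inv₂ {k : F} (h1 : k ∈ K.R 1) (h2 : k ∈ K.R 2) : ((1, k) : F × F) ∈ K.invariants := by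
  refine ⟨⟨⟨one_mem _, ?_⟩, h2⟩, ?_⟩
  · simpa using h1
  rintro ⟨p, q⟩ ⟨⟨hp, hpq⟩, hq⟩
  have hc := (commute_mod₀ K.R ((K.instNormalR 0).conj_mem' _ hp q) h1 h2).eq
  have e1 : rcomm (p * 1) (q * k) = p⁻¹ * k⁻¹ * ((q⁻¹ * p * q) * k) := by unfold rcomm; group
  have e2 : p⁻¹ * k⁻¹ * (k * (q⁻¹ * p * q)) = rcomm p q := by unfold rcomm; group
  change ((rcomm (p * 1) (q * k) : F) : F ⧸ commProd K.R) = (rcomm p q : F)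
  calc ((rcomm (p * 1) (q * k) : F) : F ⧸ commProd K.R)
      = ((p⁻¹ * k⁻¹ : F) : F ⧸ commProd K.R) * (((q⁻¹ * p * q : F) : F ⧸ commProd K.R) * k) := by
        rw [e1]; rfl
    _ = (rcomm p q : F) := by rw [hc, ← e2]; rfl

theorem core₀ (x : K.pairGroup) {k : F} (h0 : k ∈ K.R 0) (h1 : k ∈ K.R 1)
    (hx : x.1 = (k, 1)) : x ∈ K.invCore := by
  rintro ⟨⟨p, q⟩, hpq⟩
  refine Subgroup.mem_subgroupOf.2 ?_
  have : (⟨(p, q), hpq⟩ * x * ⟨(p, q), hpq⟩⁻¹ : K.pairGroup).1 = (p * k * p⁻¹, 1) := by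
    change (p, q) * x.1 * (p, q)⁻¹ = _
    rw [hx]; simp
  rw [this]
  exact inv₀ ((K.instNormalR 0).conj_mem _ h0 p) ((K.instNormalR 1).conj_mem _ h1 p)

theorem core₁ (x : K.pairGroup) {k : F} (h0 : k ∈ K.R 0) (h2 : k ∈ K.R 2)
    (hx : x.1 = (k, k)) : x ∈ K.invCore := by
  rintro ⟨⟨p, q⟩, hp, hpq⟩
  refine Subgroup.mem_subgroupOf.2 ?_
  have : (⟨(p, q), hp, hpq⟩ * x * ⟨(p, q), hp, hpq⟩⁻¹ : K.pairGroup).1 =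
      (p * k * p⁻¹, p * k * p⁻¹) *
        (1, p * (k⁻¹ * ((p⁻¹ * q) * k * (p⁻¹ * q)⁻¹)) * p⁻¹) := by
    change (p, q) * x.1 * (p, q)⁻¹ = _
    rw [hx]
    refine Prod.ext ?_ ?_
    · simp
    · simp only [Prod.snd_mul, Prod.snd_inv]; group
  rw [this]
  refine mul_mem (inv₁ ((K.instNormalR 0).conj_mem _ h0 p) ((K.instNormalR 2).conj_mem _ h2 p))
    (inv₂ ((K.instNormalR 1).conj_mem _ ?_ p) ((K.instNormalR 2).conj_mem _ ?_ p))
  · have e : k⁻¹ * ((p⁻¹ * q) * k * (p⁻¹ * q)⁻¹) = (k⁻¹ * (p⁻¹ * q) * k) * (p⁻¹ * q)⁻¹ := by group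
    rw [e]
    exact mul_mem ((K.instNormalR 1).conj_mem' _ hpq k) ((K.R 1).inv_mem hpq)
  · exact mul_mem ((K.R 2).inv_mem h2) ((K.instNormalR 2).conj_mem _ h2 _)

theorem core₂ (x : K.pairGroup) {k : F} (h1 : k ∈ K.R 1) (h2 : k ∈ K.R 2)
    (hx : x.1 = (1, k)) : x ∈ K.invCore := by
  rintro ⟨⟨p, q⟩, hpq⟩
  refine Subgroup.mem_subgroupOf.2 ?_
  have : (⟨(p, q), hpq⟩ * x * ⟨(p, q), hpq⟩⁻¹ : K.pairGroup).1 = (1, q * k * q⁻¹) := by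
    change (p, q) * x.1 * (p, q)⁻¹ = _
    rw [hx]; simp
  rw [this]
  exact inv₂ ((K.instNormalR 1).conj_mem _ h1 q) ((K.instNormalR 2).conj_mem _ h2 q)

/-- Auxiliary: the pair of an element `c` carrying the index `i`. -/
def pr (i : Fin 3) : F →* F × F :=
  if i = 0 then (MonoidHom.id F).prod (MonoidHom.id F)
  else if i = 1 then (1 : F →* F).prod (MonoidHom.id F) else 1

theorem pr_zero (c : F) : pr 0 c = (c, c) := rfl
theorem pr_one (c : F) : pr 1 c = (1, c) := rfl
theorem pr_two (c : F) : pr 2 c = (1, 1) := rfl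

theorem pr_mem {i : Fin 3} {c : F} (hc : c ∈ K.R i) : pr i c ∈ K.pairGroup := by
  fin_cases i
  · exact ⟨hc, by simp [pr_zero, one_mem]⟩
  · exact ⟨one_mem _, by simpa [pr_one] using hc⟩
  · exact one_mem _

variable (K) in
/-- Auxiliary: the class of `pr i c`. -/
def prQ (i : Fin 3) : K.R i →* K.pairGroup ⧸ K.invCore :=
  (QuotientGroup.mk' K.invCore).comp
    (((pr i).comp (K.R i).subtype).codRestrict K.pairGroup (fun x => pr_mem x.2))

theorem prQ_indep {i j : Fin 3} {c : F} (hi : c ∈ K.R i) (hj : c ∈ K.R j) :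
    prQ K i ⟨c, hi⟩ = prQ K j ⟨c, hj⟩ := by
  fin_cases i <;> fin_cases j
  · rfl
  · refine (QuotientGroup.eq.2 (core₀ _ (inv_mem hi) (inv_mem hj) ?_))
    change (pr 0 c)⁻¹ * pr 1 c = _
    simp [pr_zero, pr_one]
  · refine (QuotientGroup.eq.2 (core₁ _ (inv_mem hi) (inv_mem hj) ?_))
    change (pr 0 c)⁻¹ * pr 2 c = _
    simp [pr_zero, pr_two]
  · refine (QuotientGroup.eq.2 (core₀ _ hj hi ?_))
    change (pr 1 c)⁻¹ * pr 0 c = _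
    simp [pr_zero, pr_one]
  · rfl
  · refine (QuotientGroup.eq.2 (core₂ _ (inv_mem hi) (inv_mem hj) ?_))
    change (pr 1 c)⁻¹ * pr 2 c = _
    simp [pr_one, pr_two]
  · refine (QuotientGroup.eq.2 (core₁ _ hj hi ?_))
    change (pr 2 c)⁻¹ * pr 0 c = _
    simp [pr_zero, pr_two]
  · refine (QuotientGroup.eq.2 (core₂ _ hj hi ?_))
    change (pr 2 c)⁻¹ * pr 1 c = _
    simp [pr_one, pr_two]
  · rfl

theorem prQ_peiffer {i j : Fin 3} {c d : F} (hc : c ∈ K.R i) (hd : d ∈ K.R j)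
    (hcd : c * d * c⁻¹ ∈ K.R j) :
    prQ K i ⟨c, hc⟩ * prQ K j ⟨d, hd⟩ * (prQ K i ⟨c, hc⟩)⁻¹ = prQ K j ⟨c * d * c⁻¹, hcd⟩ := by
  have hk : c * d⁻¹ * c⁻¹ * d ∈ K.R j := by
    have e : c * d⁻¹ * c⁻¹ * d = (c * d * c⁻¹)⁻¹ * d := by group
    rw [e]; exact mul_mem (inv_mem hcd) hd
  have hk' : d⁻¹ * c * d * c⁻¹ ∈ K.R i :=
    mul_mem ((K.instNormalR i).conj_mem' _ hc d) ((K.R i).inv_mem hc)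
  have hk2 : d⁻¹ * c * d * c⁻¹ ∈ K.R j := by
    have e : d⁻¹ * c * d * c⁻¹ = d⁻¹ * (c * d * c⁻¹) := by group
    rw [e]; exact mul_mem (inv_mem hd) hcd
  have key : ∀ x : K.pairGroup,
      x.1 = (pr i c * pr j d * (pr i c)⁻¹)⁻¹ * pr j (c * d * c⁻¹) → x ∈ K.invCore →
      prQ K i ⟨c, hc⟩ * prQ K j ⟨d, hd⟩ * (prQ K i ⟨c, hc⟩)⁻¹ = prQ K j ⟨c * d * c⁻¹, hcd⟩ := by
    intro x hx hxN
    refine QuotientGroup.eq.2 ?_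
    convert hxN
    exact Subtype.ext hx.symm
  have hmem : (pr i c * pr j d * (pr i c)⁻¹)⁻¹ * pr j (c * d * c⁻¹) ∈ K.pairGroup :=
    mul_mem (inv_mem (mul_mem (mul_mem (pr_mem hc) (pr_mem hd)) (inv_mem (pr_mem hc))))
      (pr_mem hcd)
  refine key ⟨_, hmem⟩ rfl ?_
  fin_cases i <;> fin_cases j
  · convert one_mem K.invCore
    simp [pr_zero, mul_assoc]
  · convert one_mem K.invCore
    simp [pr_zero, pr_one, mul_assoc]
  · convert one_mem K.invCore
    simp [pr_zero, pr_two]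
  · refine core₀ _ hk2 hk' ?_
    simp [pr_zero, pr_one, mul_assoc]
  · convert one_mem K.invCore
    simp [pr_one, mul_assoc]
  · convert one_mem K.invCore
    simp [pr_one, pr_two]
  · refine core₁ _ hk2 hk' ?_
    simp [pr_zero, pr_two, mul_assoc]
  · refine core₂ _ hk2 hk' ?_
    simp [pr_one, pr_two, mul_assoc]
  · convert one_mem K.invCore
    simp [pr_two]

theorem conj_attach_mem {i : Fin 3} {α : K.Cell} (h : α ∈ K.sub i) (w : F) :
    w * K.attach α * w⁻¹ ∈ K.R i := by
  simpa [Letter.val] using (⟨i, ⟨α, h⟩, w, false⟩ : K.Letter).val_mem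

variable (K) in
/-- Auxiliary homomorphism on `π₂(K, K¹)` computing `(r_c, r_c s_c)` modulo `invCore`. -/
noncomputable def pairHom : RelPi2 K.attach →* K.pairGroup ⧸ K.invCore :=
  PresentedGroup.toGroup
    (f := fun x : K.Cell × F => prQ K (K.cover x.1).choose
      ⟨x.2 * K.attach x.1 * x.2⁻¹, conj_attach_mem (K.cover x.1).choose_spec x.2⟩) (by
    rintro _ ⟨α, β, p, q, rfl⟩
    simp only [map_mul, map_inv, FreeGroup.lift_apply_of]
    rw [prQ_peiffer _ _ ((K.instNormalR _).conj_mem _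
      (conj_attach_mem (K.cover β).choose_spec q) _), mul_inv_eq_one]
    congr 2
    group)

theorem pairHom_cellGen (α : K.Cell) (w : F) {i : Fin 3} (h : α ∈ K.sub i) :
    pairHom K (cellGen K.attach α w) = prQ K i ⟨w * K.attach α * w⁻¹, conj_attach_mem h w⟩ :=
  (PresentedGroup.toGroup.of _).trans (prQ_indep _ _)

theorem pairHom_rel (l : K.Letter) : pairHom K l.rel = prQ K l.idx ⟨l.val, l.val_mem⟩ := by
  have h := pairHom_cellGen l.cell.1 l.conj l.cell.2
  by_cases hn : l.neg
  · simp only [Letter.rel, hn, if_true, map_inv, h]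
    rw [← map_inv]
    congr 1
    exact Subtype.ext (by simp [Letter.val, hn])
  · simp only [Letter.rel, hn]
    refine h.trans (congrArg _ (Subtype.ext ?_))
    simp [Letter.val, hn]

theorem parts_mem (c : List K.Letter) : (rPart c, rPart c * sPart c) ∈ K.pairGroup :=
  ⟨rPart_mem c, by simpa using sPart_mem c⟩

theorem pairHom_prod (c : List K.Letter) :
    pairHom K (c.map Letter.rel).prod =
      QuotientGroup.mk (⟨(rPart c, rPart c * sPart c), parts_mem c⟩ : K.pairGroup) := by
  induction c with
  | nil =>
    rw [List.map_nil, List.prod_nil, map_one]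
    have e : (⟨(rPart [], rPart [] * sPart []), parts_mem []⟩ : K.pairGroup) = 1 :=
      Subtype.ext (Prod.ext rfl (mul_one (1 : F)))
    rw [e]
    rfl
  | cons l c ih =>
    rw [List.map_cons, List.prod_cons, map_mul, ih, pairHom_rel]
    change QuotientGroup.mk ((⟨pr l.idx l.val, pr_mem l.val_mem⟩ : K.pairGroup) *
      ⟨(rPart c, rPart c * sPart c), parts_mem c⟩) = _
    congr 1
    refine Subtype.ext ?_
    change pr l.idx l.val * (rPart c, rPart c * sPart c) =
      (rPart (l :: c), rPart (l :: c) * sPart (l :: c))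
    have : l.idx = 0 ∨ l.idx = 1 ∨ l.idx = 2 := by
      generalize l.idx = i
      fin_cases i <;> simp
    rcases this with h | h | h <;>
      simp [rPart, sPart, h, mul_assoc, pr_zero, pr_one, pr_two]

theorem pairHom_relIncl (i : Fin 3) (x : RelPi2 (fun a : K.sub i => K.attach a)) :
    ∃ h : bdry _ x ∈ K.R i, pairHom K (relIncl K.attach (K.sub i) x) = prQ K i ⟨bdry _ x, h⟩ := by
  have hx : x ∈ Subgroup.closure (Set.range (PresentedGroup.of
      (rels := peifferRels (fun a : K.sub i => K.attach a)))) := by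
    rw [PresentedGroup.closure_range_of]; trivial
  induction hx using Subgroup.closure_induction with
  | mem x hx =>
    obtain ⟨⟨α, w⟩, rfl⟩ := hx
    have h1 := bdry_cellGen (fun a : K.sub i => K.attach a) α w
    have h2 := relIncl_cellGen K.attach (K.sub i) α w
    have h3 := pairHom_cellGen α.1 w α.2
    unfold cellGen at h1 h2 h3
    refine ⟨h1 ▸ conj_attach_mem α.2 w, ?_⟩
    rw [h2, h3]
    exact congrArg _ (Subtype.ext h1.symm)
  | one =>
    refine ⟨by rw [map_one]; exact one_mem _, ?_⟩
    rw [map_one, map_one, ← map_one (prQ K i)]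
    exact congrArg _ (Subtype.ext (map_one _).symm)
  | mul x y _ _ hx hy =>
    obtain ⟨h1, h2⟩ := hx
    obtain ⟨h3, h4⟩ := hy
    refine ⟨by rw [map_mul]; exact mul_mem h1 h3, ?_⟩
    rw [map_mul, map_mul, h2, h4, ← map_mul]
    exact congrArg _ (Subtype.ext (map_mul _ _ _).symm)
  | inv x _ hx =>
    obtain ⟨h1, h2⟩ := hx
    refine ⟨by rw [map_inv]; exact inv_mem h1, ?_⟩
    rw [map_inv, map_inv, h2, ← map_inv]
    exact congrArg _ (Subtype.ext (map_inv _ _).symm)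

theorem subSum_le : K.subSum ≤
    (MonoidHom.toAdditive ((pairHom K).comp (bdry K.attach).ker.subtype)).ker := by
  refine iSup_le fun i => ?_
  rintro _ ⟨x, rfl⟩
  obtain ⟨h, hx⟩ := pairHom_relIncl i (Additive.toMul x).1
  refine Eq.trans (b := Additive.ofMul _) (congrArg Additive.ofMul hx) ?_
  have e : (⟨_, h⟩ : K.R i) = 1 := Subtype.ext (Additive.toMul x).2
  rw [e, map_one]
  rfl

/-- The class of `[r_c, s_c]` depends only on the class of `c` in
`π₂(K) / (i₁ π₂(K₁) + i₂ π₂(K₂) + i₃ π₂(K₃))`. -/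
theorem value_eq {c d : K.IdSeq}
    (h : (QuotientAddGroup.mk c.cls : Pi2 K.attach ⧸ K.subSum) = QuotientAddGroup.mk d.cls) :
    c.value = d.value := by
  have h1 := subSum_le (QuotientAddGroup.eq.1 h)
  have h2 : (pairHom K (c.1.map Letter.rel).prod)⁻¹ * pairHom K (d.1.map Letter.rel).prod = 1 := by
    rw [← map_inv, ← map_mul]
    exact h1
  have h3 := inv_mul_eq_one.1 h2
  rw [pairHom_prod, pairHom_prod] at h3
  have h4 := (QuotientGroup.eq.1 h3) 1
  rw [one_mul, inv_one, mul_one] at h4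
  have h5 := (Subgroup.mem_subgroupOf.1 h4).2 (c.r, c.r * c.s) ⟨parts_mem c.1, c.r_mul_s_mem⟩
  refine I3.mk_eq_of K.R _ _ ?_
  have e : ∀ a b : F, rcomm a b = rcomm a (a * b) := by intro a b; unfold rcomm; group
  rw [e c.r, e d.r, ← h5]
  congr 1
  symm
  change rcomm (rPart d.1) (rPart d.1 * sPart d.1) =
    rcomm (rPart c.1 * ((rPart c.1)⁻¹ * rPart d.1))
      ((rPart c.1 * sPart c.1) * ((rPart c.1 * sPart c.1)⁻¹ * (rPart d.1 * sPart d.1)))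
  rw [mul_inv_cancel_left, mul_inv_cancel_left]

end WellDefined

/-- Every element of `π₂(K)` is represented by an identity sequence. -/
theorem exists_cls (a : Pi2 K.attach) : ∃ c : K.IdSeq, c.cls = a := by
  have hx : (Additive.toMul a).1 ∈
      Subgroup.closure (Set.range (PresentedGroup.of (rels := peifferRels K.attach))) := by
    rw [PresentedGroup.closure_range_of]; trivial
  rw [← Subgroup.mem_toSubmonoid, Subgroup.closure_toSubmonoid] at hx
  obtain ⟨l, hl, hprod⟩ := Submonoid.exists_list_of_mem_closure hx
  have key : ∀ l : List (RelPi2 K.attach),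
      (∀ x ∈ l, x ∈ Set.range (PresentedGroup.of (rels := peifferRels K.attach)) ∨
        x⁻¹ ∈ Set.range (PresentedGroup.of (rels := peifferRels K.attach))) →
      ∃ c : List K.Letter, c.map Letter.rel = l := by
    intro l
    induction l with
    | nil => exact fun _ => ⟨[], rfl⟩
    | cons x l ih =>
      intro h
      obtain ⟨c, hc⟩ := ih fun y hy => h y (List.mem_cons_of_mem _ hy)
      rcases h x List.mem_cons_self with ⟨⟨α, w⟩, hα⟩ | ⟨⟨α, w⟩, hα⟩
      · obtain ⟨i, hi⟩ := K.cover α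
        exact ⟨⟨i, ⟨α, hi⟩, w, false⟩ :: c, by
          rw [List.map_cons, hc, ← hα]; rfl⟩
      · obtain ⟨i, hi⟩ := K.cover α
        exact ⟨⟨i, ⟨α, hi⟩, w, true⟩ :: c, by
          rw [List.map_cons, hc, ← inv_inv x, ← hα]; rfl⟩
  obtain ⟨c, rfl⟩ := key l hl
  refine ⟨⟨c, ?_⟩, congrArg Additive.ofMul (Subtype.ext hprod)⟩
  rw [← bdry_prod_rel, hprod]
  exact (Additive.toMul a).2

theorem exists_mk_cls (x : Pi2 K.attach ⧸ K.subSum) :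
    ∃ c : K.IdSeq, (QuotientAddGroup.mk c.cls : Pi2 K.attach ⧸ K.subSum) = x := by
  obtain ⟨a, rfl⟩ := QuotientAddGroup.mk_surjective x
  obtain ⟨c, rfl⟩ := exists_cls a
  exact ⟨c, rfl⟩

variable (K)

/-- `Λ_x : π₂(K) / (i₁ π₂(K₁) + i₂ π₂(K₂) + i₃ π₂(K₃)) → I₃(F; R₁, R₂, R₃)`, sending the class of
any identity sequence `c` to the class of `[r_c, s_c]`; see `lambdaX_mk_cls`. -/
noncomputable def lambdaX (x : Pi2 K.attach ⧸ K.subSum) : I3 K.R := (exists_mk_cls x).choose.value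

/-- The composite `Λ : π₂(K) → π₂(K) / (i₁ π₂(K₁) + i₂ π₂(K₂) + i₃ π₂(K₃)) → I₃(F; R₁, R₂, R₃)`. -/
noncomputable def lambda (a : Pi2 K.attach) : I3 K.R := K.lambdaX (QuotientAddGroup.mk a)

variable {K}

theorem lambdaX_mk_cls (c : K.IdSeq) : K.lambdaX (QuotientAddGroup.mk c.cls) = c.value :=
  value_eq (exists_mk_cls (QuotientAddGroup.mk c.cls : Pi2 K.attach ⧸ K.subSum)).choose_spec

theorem lambda_cls (c : K.IdSeq) : K.lambda c.cls = c.value := lambdaX_mk_cls c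

end TriComplex

/-- A map `f` of abelian groups is homogeneous quadratic if its cross-effect
`f (a + b) - f a - f b` is bilinear and `f (-x) = f x`. -/
def IsHomogeneousQuadratic {A B : Type*} [AddCommGroup A] [AddCommGroup B] (f : A → B) : Prop :=
  (∃ β : A →+ A →+ B, ∀ a b, β a b = f (a + b) - f a - f b) ∧ ∀ x, f (-x) = f x

/-!
For identity sequences `c`, `d` put `x₁ = r_c`, `y₁ = s_c`, `x₂ = r_d`, `y₂ = s_d`. Concatenation
gives `r = x₁ x₂` and `s = y₁^{x₂} y₂`, so the cross-effect of `Λ` is read off from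
`[x₁ x₂, y₁^{x₂} y₂]`. Modulo `commProd K.R` each of `R₁, R₂, R₃` centralizes the intersection of
the other two. Hence `[x₁, y₁]` and `[x₂, y₂]`, which lie in the triple intersection, are central
among elements of the `Rᵢ`, while `[x₁, y₂]` and `[x₂, y₁]`, which lie in `R₁ ∩ R₂`, commute with
`x₁ y₁, x₂ y₂ ∈ R₃`; so conjugating them by `xᵢ` is the same as conjugating by `yᵢ⁻¹`. Collecting
the commutators yields `Λ(a, b) = [y₂⁻¹, x₁] [y₁⁻¹, x₂]` (`rcomm_concat`).

Replacing `(x₁, y₁)` by `(x₁ x₃, y₁^{x₃} y₃)` in this expression, additivity comes down to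
`y₁^{x₃} ∈ R₂` commuting with a conjugate of `[x₂⁻¹, (x₃ y₃)⁻¹] ∈ R₁ ∩ R₃` (`crossTerm_concat`);
additivity in the other variable follows because the cross-effect is symmetric. Finally
`[y⁻¹, x]` is the conjugate of `[x, y]` by `y⁻¹`, so `Λ(a, a) = 2 Λ(a)`, which for a map with
bilinear cross-effect is equivalent to `Λ(-a) = Λ(a)`.
-/

/-- The expression `[y₂⁻¹, x₁] [y₁⁻¹, x₂]` representing the cross-effect of `Λ`. -/
def crossTerm {G : Type*} [Group G] (x₁ y₁ x₂ y₂ : G) : G := rcomm y₂⁻¹ x₁ * rcomm y₁⁻¹ x₂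

/-! ### Commutator identities -/

/-- Expansion of `[x₁ x₂, y₁^{x₂} y₂]` under the commutation rules valid modulo `commProd`. -/
theorem rcomm_concat {G : Type*} [Group G] {x₁ y₁ x₂ y₂ : G}
    (h₁x : Commute (rcomm x₁ y₁) x₂) (h₁y : Commute (rcomm x₁ y₁) y₂)
    (h₂ : Commute (rcomm x₂ y₂) (rcomm y₁⁻¹ x₂))
    (h₁₂ : Commute (rcomm x₁ y₂) (x₂ * y₂)) (h₂₁ : Commute (rcomm x₂ y₁) (x₁ * y₁))
    (h : Commute (rcomm y₁⁻¹ x₂) (x₂ * y₂)) :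
    rcomm (x₁ * x₂) (x₂⁻¹ * y₁ * x₂ * y₂) =
      crossTerm x₁ y₁ x₂ y₂ * rcomm x₂ y₂ * rcomm x₁ y₁ := by
  -- Conjugation by `xᵢ` agrees with conjugation by `yᵢ⁻¹` on elements commuting with `xᵢ yᵢ`.
  have e₁ : x₂⁻¹ * rcomm x₁ y₂ * x₂ = rcomm y₂⁻¹ x₁ := by
    calc x₂⁻¹ * rcomm x₁ y₂ * x₂
        = x₂⁻¹ * (rcomm x₁ y₂ * (x₂ * y₂)) * y₂⁻¹ := by group
      _ = rcomm y₂⁻¹ x₁ := by rw [h₁₂.eq]; unfold rcomm; group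
  have e₂ : x₁⁻¹ * rcomm x₂ y₁ * x₁ = rcomm y₁⁻¹ x₂ := by
    calc x₁⁻¹ * rcomm x₂ y₁ * x₁
        = x₁⁻¹ * (rcomm x₂ y₁ * (x₁ * y₁)) * y₁⁻¹ := by group
      _ = rcomm y₁⁻¹ x₂ := by rw [h₂₁.eq]; unfold rcomm; group
  calc rcomm (x₁ * x₂) (x₂⁻¹ * y₁ * x₂ * y₂)
      = x₂⁻¹ * rcomm x₁ y₂ * y₂⁻¹ * (x₁⁻¹ * rcomm x₂ y₁ * x₁) *
          (rcomm x₁ y₁ * (x₂ * y₂)) := by unfold rcomm; group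
    _ = x₂⁻¹ * rcomm x₁ y₂ * y₂⁻¹ * (rcomm y₁⁻¹ x₂ * (x₂ * y₂)) * rcomm x₁ y₁ := by
        rw [e₂, (h₁x.mul_right h₁y).eq]; group
    _ = (x₂⁻¹ * rcomm x₁ y₂ * x₂) * (rcomm x₂ y₂ * rcomm y₁⁻¹ x₂) * rcomm x₁ y₁ := by
        rw [h.eq]; unfold rcomm; group
    _ = crossTerm x₁ y₁ x₂ y₂ * rcomm x₂ y₂ * rcomm x₁ y₁ := by
        rw [e₁, h₂.eq]; unfold crossTerm; group

/-- Additivity of `crossTerm` in its first pair, under the commutation rules valid modulo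
`commProd`. -/
theorem crossTerm_concat {G : Type*} [Group G] {x₁ y₁ x₂ y₂ x₃ y₃ : G}
    (hx : Commute (crossTerm x₁ y₁ x₂ y₂) x₃)
    (hc : Commute (crossTerm x₁ y₁ x₂ y₂) (rcomm y₂⁻¹ x₃))
    (hq : Commute (x₃⁻¹ * y₁ * x₃)
      (x₃⁻¹ * (x₂ * (x₃ * y₃) * x₂⁻¹ * (x₃ * y₃)⁻¹) * x₃)) :
    crossTerm (x₁ * x₃) (x₃⁻¹ * y₁ * x₃ * y₃) x₂ y₂ =
      crossTerm x₁ y₁ x₂ y₂ * crossTerm x₃ y₃ x₂ y₂ := by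
  have hx' : x₃⁻¹ * crossTerm x₁ y₁ x₂ y₂ * x₃ = crossTerm x₁ y₁ x₂ y₂ := by
    rw [mul_assoc, hx.eq, inv_mul_cancel_left]
  calc crossTerm (x₁ * x₃) (x₃⁻¹ * y₁ * x₃ * y₃) x₂ y₂
      = rcomm y₂⁻¹ x₃ * (x₃⁻¹ * crossTerm x₁ y₁ x₂ y₂ * x₃) * (x₃⁻¹ * x₂⁻¹ * x₃) *
          ((x₃⁻¹ * y₁ * x₃) * (x₃⁻¹ * (x₂ * (x₃ * y₃) * x₂⁻¹ * (x₃ * y₃)⁻¹) * x₃)) *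
          (x₃⁻¹ * y₁ * x₃)⁻¹ * x₂ := by unfold crossTerm rcomm; group
    _ = rcomm y₂⁻¹ x₃ * crossTerm x₁ y₁ x₂ y₂ * (x₃⁻¹ * x₂⁻¹ * x₃) *
          ((x₃⁻¹ * (x₂ * (x₃ * y₃) * x₂⁻¹ * (x₃ * y₃)⁻¹) * x₃) * (x₃⁻¹ * y₁ * x₃)) *
          (x₃⁻¹ * y₁ * x₃)⁻¹ * x₂ := by rw [hx', hq.eq]
    _ = crossTerm x₁ y₁ x₂ y₂ * rcomm y₂⁻¹ x₃ * (x₃⁻¹ * x₂⁻¹ * x₃) *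
          ((x₃⁻¹ * (x₂ * (x₃ * y₃) * x₂⁻¹ * (x₃ * y₃)⁻¹) * x₃) * (x₃⁻¹ * y₁ * x₃)) *
          (x₃⁻¹ * y₁ * x₃)⁻¹ * x₂ := by rw [hc.eq]
    _ = crossTerm x₁ y₁ x₂ y₂ * crossTerm x₃ y₃ x₂ y₂ := by
        conv_rhs => rw [crossTerm.eq_def x₃]
        unfold rcomm; group

theorem crossTerm_self {G : Type*} [Group G] {x y : G} (h : Commute (rcomm x y) y) :
    crossTerm x y x y = rcomm x y * rcomm x y := by
  have e : rcomm y⁻¹ x = rcomm x y := by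
    calc rcomm y⁻¹ x = y * rcomm x y * y⁻¹ := by unfold rcomm; group
      _ = rcomm x y := by rw [← h.eq, mul_inv_cancel_right]
  rw [crossTerm, e]

theorem rcomm_mem_of_mem_left {G : Type*} [Group G] {N : Subgroup G} [hN : N.Normal] {x : G}
    (hx : x ∈ N) (y : G) : rcomm x y ∈ N := by
  have e : rcomm x y = x⁻¹ * (y⁻¹ * x * y) := by unfold rcomm; group
  rw [e]
  exact mul_mem (inv_mem hx) (hN.conj_mem' _ hx y)

theorem rcomm_mem_of_mem_right {G : Type*} [Group G] {N : Subgroup G} [hN : N.Normal] (x : G)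
    {y : G} (hy : y ∈ N) : rcomm x y ∈ N :=
  mul_mem (hN.conj_mem' _ (inv_mem hy) x) hy

/-! ### The cross-effect in `I₃` -/

namespace TriComplex

variable {F : Type u} [Group F] {K : TriComplex.{u, v} F}

theorem IdSeq.r_mem (c : K.IdSeq) : c.r ∈ K.R 0 := rPart_mem c.1

theorem IdSeq.s_mem (c : K.IdSeq) : c.s ∈ K.R 1 := sPart_mem c.1

theorem rPart_append (c d : List K.Letter) : rPart (c ++ d) = rPart c * rPart d := by
  induction c with
  | nil => simp [rPart]
  | cons l c ih =>
    rw [List.cons_append, rPart, rPart, ih]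
    split_ifs <;> simp [mul_assoc]

theorem sPart_append (c d : List K.Letter) :
    sPart (c ++ d) = (rPart d)⁻¹ * sPart c * rPart d * sPart d := by
  induction c with
  | nil => simp [sPart]
  | cons l c ih =>
    rw [List.cons_append, sPart, sPart, ih, rPart_append]
    split_ifs
    · group
    · rfl

/-- Concatenation of identity sequences. -/
def IdSeq.append (c d : K.IdSeq) : K.IdSeq :=
  ⟨c.1 ++ d.1, by rw [List.map_append, List.prod_append, c.2, d.2, one_mul]⟩

theorem IdSeq.cls_append (c d : K.IdSeq) : (c.append d).cls = c.cls + d.cls :=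
  congrArg Additive.ofMul (Subtype.ext (by
    change ((c.1 ++ d.1).map Letter.rel).prod = _
    rw [List.map_append, List.prod_append]
    rfl))

theorem IdSeq.r_append (c d : K.IdSeq) : (c.append d).r = c.r * d.r := rPart_append _ _

theorem IdSeq.s_append (c d : K.IdSeq) : (c.append d).s = d.r⁻¹ * c.s * d.r * d.s :=
  sPart_append _ _

theorem commute_of_mem_tripleInf₀ {a z : F} (hz : z ∈ tripleInf K.R) (ha : a ∈ K.R 0) :
    Commute (z : F ⧸ commProd K.R) a :=
  (commute_mod₀ K.R ha hz.1.2 hz.2).symm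

theorem commute_of_mem_tripleInf₁ {a z : F} (hz : z ∈ tripleInf K.R) (ha : a ∈ K.R 1) :
    Commute (z : F ⧸ commProd K.R) a :=
  (commute_mod₁ K.R ha hz.2 hz.1.1).symm

theorem IdSeq.rcomm_mem (c : K.IdSeq) : rcomm c.r c.s ∈ tripleInf K.R :=
  TriComplex.rcomm_mem c.r_mem c.s_mem c.r_mul_s_mem

theorem IdSeq.mk_s_eq (c : K.IdSeq) : (c.s : F ⧸ K.R 2) = (c.r : F ⧸ K.R 2)⁻¹ := by
  rw [eq_inv_iff_mul_eq_one]
  exact (QuotientGroup.eq_one_iff _).2 ((K.instNormalR 2).mem_comm c.r_mul_s_mem)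

theorem crossTerm_mem (c d : K.IdSeq) : crossTerm c.r c.s d.r d.s ∈ tripleInf K.R := by
  refine ⟨⟨mul_mem (rcomm_mem_of_mem_right _ c.r_mem) (rcomm_mem_of_mem_right _ d.r_mem),
    mul_mem (rcomm_mem_of_mem_left (inv_mem d.s_mem) _)
      (rcomm_mem_of_mem_left (inv_mem c.s_mem) _)⟩, ?_⟩
  -- Modulo `R₃` the two factors become `[x₂, x₁]` and `[x₁, x₂]`.
  refine (QuotientGroup.eq_one_iff _).1 ?_
  simp only [crossTerm, rcomm, QuotientGroup.mk_mul, QuotientGroup.mk_inv, IdSeq.mk_s_eq]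
  group

/-- The class of `[y₂⁻¹, x₁] [y₁⁻¹, x₂]` in `I₃`. -/
def crossValue (c d : K.IdSeq) : I3 K.R := I3.mk K.R (crossTerm c.r c.s d.r d.s) (crossTerm_mem c d)

theorem value_append (c d : K.IdSeq) :
    (c.append d).value = crossValue c d + d.value + c.value := by
  refine I3.mk_eq_of K.R _ (mul_mem (mul_mem (crossTerm_mem c d) d.rcomm_mem) c.rcomm_mem) ?_
  rw [IdSeq.r_append, IdSeq.s_append]
  exact rcomm_concat (G := F ⧸ commProd K.R) (x₁ := c.r) (y₁ := c.s) (x₂ := d.r) (y₂ := d.s)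
    (commute_of_mem_tripleInf₀ c.rcomm_mem d.r_mem)
    (commute_of_mem_tripleInf₁ c.rcomm_mem d.s_mem)
    (commute_of_mem_tripleInf₀ d.rcomm_mem (rcomm_mem_of_mem_right _ d.r_mem))
    (commute_mod₂ K.R d.r_mul_s_mem (rcomm_mem_of_mem_left c.r_mem _)
      (rcomm_mem_of_mem_right _ d.s_mem)).symm
    (commute_mod₂ K.R c.r_mul_s_mem (rcomm_mem_of_mem_left d.r_mem _)
      (rcomm_mem_of_mem_right _ c.s_mem)).symm
    (commute_mod₂ K.R d.r_mul_s_mem (rcomm_mem_of_mem_right _ d.r_mem)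
      (rcomm_mem_of_mem_left (inv_mem c.s_mem) _)).symm

theorem crossValue_append (c d e : K.IdSeq) :
    crossValue (c.append e) d = crossValue c d + crossValue e d := by
  refine I3.mk_eq_of K.R _ (mul_mem (crossTerm_mem c d) (crossTerm_mem e d)) ?_
  rw [IdSeq.r_append, IdSeq.s_append]
  refine crossTerm_concat (G := F ⧸ commProd K.R) (x₁ := c.r) (y₁ := c.s) (x₂ := d.r) (y₂ := d.s)
    (x₃ := e.r) (y₃ := e.s)
    (commute_of_mem_tripleInf₀ (crossTerm_mem c d) e.r_mem)
    (commute_of_mem_tripleInf₀ (crossTerm_mem c d) (rcomm_mem_of_mem_right d.s⁻¹ e.r_mem))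
    (commute_mod₁ K.R ((K.instNormalR 1).conj_mem' _ c.s_mem e.r)
      ((K.instNormalR 2).conj_mem' _ ?_ e.r) ((K.instNormalR 0).conj_mem' _ ?_ e.r))
  · exact mul_mem ((K.instNormalR 2).conj_mem _ e.r_mul_s_mem d.r) (inv_mem e.r_mul_s_mem)
  · have h := mul_mem d.r_mem ((K.instNormalR 0).conj_mem _ (inv_mem d.r_mem) (e.r * e.s))
    simpa only [mul_assoc] using h

theorem crossValue_self (c : K.IdSeq) : crossValue c c = c.value + c.value := by
  refine I3.mk_eq_of K.R _ (mul_mem c.rcomm_mem c.rcomm_mem) ?_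
  exact crossTerm_self (x := (c.r : F ⧸ commProd K.R)) (y := c.s)
    (commute_of_mem_tripleInf₁ c.rcomm_mem c.s_mem)

theorem lambda_crossEffect (c d : K.IdSeq) :
    K.lambda (c.cls + d.cls) - K.lambda c.cls - K.lambda d.cls = crossValue c d := by
  rw [← IdSeq.cls_append, lambda_cls, lambda_cls, lambda_cls, value_append]
  abel

theorem lambda_crossEffect_add_left (a b e : Pi2 K.attach) :
    K.lambda (a + e + b) - K.lambda (a + e) - K.lambda b =
      (K.lambda (a + b) - K.lambda a - K.lambda b) +
        (K.lambda (e + b) - K.lambda e - K.lambda b) := by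
  obtain ⟨c, rfl⟩ := exists_cls a
  obtain ⟨d, rfl⟩ := exists_cls b
  obtain ⟨e, rfl⟩ := exists_cls e
  rw [lambda_crossEffect c, lambda_crossEffect e, ← IdSeq.cls_append, lambda_crossEffect,
    crossValue_append]

theorem lambda_crossEffect_self (a : Pi2 K.attach) :
    K.lambda (a + a) - K.lambda a - K.lambda a = K.lambda a + K.lambda a := by
  obtain ⟨c, rfl⟩ := exists_cls a
  rw [lambda_crossEffect, crossValue_self, lambda_cls]

end TriComplex

/-! ### Homogeneous quadratic maps -/

/-- The cross-effect is symmetric, so additivity in one variable suffices, and for quadratic maps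
`f (-x) = f x` amounts to the value `2 f x` of the cross-effect on the diagonal. -/
theorem isHomogeneousQuadratic_of_crossEffect {A B : Type*} [AddCommGroup A] [AddCommGroup B]
    {f : A → B}
    (hadd : ∀ a b e, f (a + e + b) - f (a + e) - f b =
      (f (a + b) - f a - f b) + (f (e + b) - f e - f b))
    (hself : ∀ a, f (a + a) - f a - f a = f a + f a) : IsHomogeneousQuadratic f := by
  have hsymm : ∀ a b, f (a + b) - f a - f b = f (b + a) - f b - f a := fun a b => by
    rw [add_comm b a, sub_right_comm]
  let β : A →+ A →+ B := AddMonoidHom.mk'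
    (fun a => AddMonoidHom.mk' (fun b => f (a + b) - f a - f b) fun b e => by
      rw [hsymm a, hsymm a, hsymm a, hadd])
    fun a e => AddMonoidHom.ext fun b => hadd a b e
  have hβ : ∀ a b, β a b = f (a + b) - f a - f b := fun _ _ => rfl
  refine ⟨⟨β, hβ⟩, fun x => ?_⟩
  have h0 : f 0 = 0 := by
    have h := hβ 0 0
    rw [map_zero, add_zero, sub_self, zero_sub] at h
    exact neg_eq_zero.1 h.symm
  have h1 : β x (-x) = -(f x + f x) := by rw [map_neg, hβ, hself]
  rw [hβ, add_neg_cancel, h0, zero_sub, sub_eq_iff_eq_add, neg_add, add_assoc, left_eq_add] at h1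
  exact (neg_add_eq_zero.1 h1).symm

theorem mainTheorem2 {F : Type u} [Group F] [IsFreeGroup F] (K : TriComplex.{u, v} F) :
    IsHomogeneousQuadratic K.lambda ∧
    ∀ c d : K.IdSeq,
      ∃ h : rcomm d.s⁻¹ c.r * rcomm c.s⁻¹ d.r ∈ tripleInf K.R,
        K.lambda (c.cls + d.cls) - K.lambda c.cls - K.lambda d.cls =
          I3.mk K.R (rcomm d.s⁻¹ c.r * rcomm c.s⁻¹ d.r) h :=
  ⟨isHomogeneousQuadratic_of_crossEffect TriComplex.lambda_crossEffect_add_left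
      TriComplex.lambda_crossEffect_self,
    fun c d => ⟨TriComplex.crossTerm_mem c d, TriComplex.lambda_crossEffect c d⟩⟩
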